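/- Let $H$ be a (finite-dimensional real smooth) Lie group and $N\subset H$ a normal subgroup such that $N$ and $K:=H/N$ (with the subspace and the quotient topology) are Lie groups, the inclusion $\iota:N\to H$ is a smooth embedding and the quotient map $\mu:H\to K$ is smooth. Let $\sigma:K\to H$ be a smooth global section of $\mu$ (not necessarily a homomorphism), and put $$\Sigma:K\times N\to H,\qquad \Sigma(k,u):=\sigma(k)\,\iota(u).$$ Write $e$ for neutral elements, $L_g,R_g$ for left and right translations. The connection form $\alpha$ determined by $\sigma$ is the one-form on $H$ with values in $T_eN$ given, for $v_h\in T_hH$, by $$\alpha(v_h)=T(\iota^{-1}\circ L_{h^{-1}})(h)\circ\bigl(\mathrm{id}_{T_hH}-T(R_{\iota(u)}\circ\sigma\circ\mu)(h)\bigr)v_h,\qquad \iota(u)=\sigma(\mu(h))^{-1}h;$$ that is, $\alpha(v_h)\in T_eN$ is the vector with $T\iota(e)\,\alpha(v_h)=TL_{h^{-1}}(h)\bigl(v_h-T(R_{\iota(u)}\circ\sigma\circ\mu)(h)v_h\bigr)$. For a manifold $M$ let $\pi^*_M:T^*M\to M$ be the projection and $\gamma_M$ the canonical one-form of $T^*M$,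 $\langle\gamma_M(\varphi),X\rangle=\langle\varphi,T\pi^*_M(\varphi)X\rangle$ for $X\in T_\varphi(T^*M)$. Let $pr^*_K,pr^*_N$ be the projections of $T^*K\times T^*N$ onto its factors, and let $$T^*\Sigma:=((T\Sigma)^{-1})^*:T^*K\times T^*N\to T^*H,\qquad T^*\Sigma(\theta_k,\chi_u)=(\theta_k\oplus\chi_u)\circ(T\Sigma(k,u))^{-1}\in T^*_{\Sigma(k,u)}H .$$ All these maps are well defined: every $T\Sigma(k,u)$ is invertible, $T^*\Sigma$ is smooth, $T\iota(e)$ is injective, and the vector $\alpha(v_h)$ exists for every $v_h$. Moreover, for all $\theta_k\in T^*_kK$ and $\chi_u\in T^*_uN$, writing a lower star for the pullback of forms, the following equality of linear forms on $T_{(\theta_k,\chi_u)}(T^*K\times T^*N)$ holds: $$\bigl((T^*\Sigma)_*\gamma_H\bigr)(\theta_k,\chi_u)=\bigl((pr^*_K)_*\gamma_K\bigr)(\theta_k,\chi_u)+\chi_u\circ TL_{u}(e)\circ\Bigl(\bigl(\Sigma\circ[(\pi^*_K\circ pr^*_K)\times(\pi^*_N\circ pr^*_N)]\bigr)_*\alpha\Bigr)(\theta_k,\chi_u),$$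 where $TL_u(e):T_eN\to T_uN$ is the differential at $e$ of the left translation of $N$ by $u$. -/

import Mathlib

open scoped Manifold ContDiff Bundle

noncomputable section

namespace Magnetic

/-! ### Cotangent bundles and one-forms -/

section Manifolds

variable {E : Type*} [NormedAddCommGroup E] [NormedSpace ℝ E]
  (M : Type*) [TopologicalSpace M] [ChartedSpace E M] [IsManifold 𝓘(ℝ, E) ∞ M]

/-- The cotangent bundle `T*M` of a smooth manifold `M` modelled on `E`: the bundle of continuous
linear maps from the tangent bundle to the trivial line bundle. It carries Mathlib's structure of
smooth manifold modelled on `E × E*`. The fibre over `x` consists of the linear forms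
`T_x M → ℝ`. -/
abbrev CotangentBundle : Type _ :=
  Bundle.TotalSpace (E →L[ℝ] ℝ)
    (fun x : M => TangentSpace 𝓘(ℝ, E) x →L[ℝ] Bundle.Trivial M ℝ x)

/-- The model with corners of the cotangent bundle of a manifold modelled on `E`. -/
abbrev cotangentModel (E : Type*) [NormedAddCommGroup E] [NormedSpace ℝ E] :
    ModelWithCorners ℝ (E × (E →L[ℝ] ℝ)) (ModelProd E (E →L[ℝ] ℝ)) :=
  𝓘(ℝ, E).prod 𝓘(ℝ, E →L[ℝ] ℝ)

variable {M}

/-- The projection `π* : T*M → M` onto the base. -/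
def cotangentProj (φ : CotangentBundle (E := E) M) : M := φ.proj

/-- The linear form `T_x M → ℝ` that an element `φ` of `T*M` over `x` is. -/
def covector (φ : CotangentBundle (E := E) M) :
    TangentSpace 𝓘(ℝ, E) (cotangentProj φ) →L[ℝ] ℝ := φ.snd

/-- The element of `T*M` given by a point and a linear form on the tangent space there. -/
def mkCovector (x : M) (φ : TangentSpace 𝓘(ℝ, E) x →L[ℝ] ℝ) : CotangentBundle (E := E) M := ⟨x, φ⟩

end Manifolds

section Forms

variable {E F : Type*} [NormedAddCommGroup E] [NormedSpace ℝ E] [NormedAddCommGroup F]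
  [NormedSpace ℝ F] {A B : Type*} [TopologicalSpace A] [TopologicalSpace B]
  (I : ModelWithCorners ℝ E A) (J : ModelWithCorners ℝ F B)
  {X Y : Type*} [TopologicalSpace X] [ChartedSpace A X] [TopologicalSpace Y] [ChartedSpace B Y]

/-- Differential one-forms on `X` with values in the vector space `V` (as mere families of linear
maps, no smoothness is imposed). -/
abbrev OneForm (X : Type*) [TopologicalSpace X] [ChartedSpace A X]
    (V : Type*) [AddCommGroup V] [Module ℝ V] [TopologicalSpace V] : Type _ :=
  (x : X) → TangentSpace I x →L[ℝ] V

variable {V : Type*} [AddCommGroup V] [Module ℝ V] [TopologicalSpace V]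

/-- The pullback of the one-form `β` by `f`: at `x` it is `β (f x) ∘ Tf(x)`. -/
def pullback (f : X → Y) (β : OneForm J Y V) : OneForm I X V :=
  fun x => (β (f x)).comp (mfderiv I J f x)

end Forms

section Canonical

variable {E E' F : Type*} [NormedAddCommGroup E] [NormedSpace ℝ E]
  [NormedAddCommGroup E'] [NormedSpace ℝ E'] [NormedAddCommGroup F] [NormedSpace ℝ F]
  (M : Type*) [TopologicalSpace M] [ChartedSpace E M] [IsManifold 𝓘(ℝ, E) ∞ M]
  {M' : Type*} [TopologicalSpace M'] [ChartedSpace E' M'] [IsManifold 𝓘(ℝ, E') ∞ M']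
  {Q : Type*} [TopologicalSpace Q] [ChartedSpace F Q] [IsManifold 𝓘(ℝ, F) ∞ Q]

/-- The canonical one-form `γ_M` of `T*M`, i.e. `⟨γ_M(φ), X⟩ = ⟨φ, Tπ*(φ) X⟩`. -/
def canonicalForm : OneForm (cotangentModel E) (CotangentBundle (E := E) M) ℝ :=
  fun φ => (covector φ).comp (mfderiv (cotangentModel E) 𝓘(ℝ, E) cotangentProj φ)

variable {M}

/-- For a map `f : M × M' → Q` whose tangent maps are invertible, the map
`T*f = ((Tf)⁻¹)* : T*M × T*M' → T*Q`. It sends `(θ, χ)` over `(x, y)` to the linear form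
`(θ ⊕ χ) ∘ (Tf(x, y))⁻¹` over `f (x, y)`, where `(θ ⊕ χ)(ξ, ν) = θ ξ + χ ν` on
`T_(x,y)(M × M') = T_x M × T_y M'`. (The value at a point where `Tf` fails to be invertible
is the zero form.) -/
def cotangentMap (f : M × M' → Q)
    (p : CotangentBundle (E := E) M × CotangentBundle (E := E') M') : CotangentBundle (E := F) Q :=
  mkCovector (f (cotangentProj p.1, cotangentProj p.2))
    (((covector p.1).coprod (covector p.2)).comp
      (mfderiv (𝓘(ℝ, E).prod 𝓘(ℝ, E')) 𝓘(ℝ, F) f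
        (cotangentProj p.1, cotangentProj p.2)).inverse)

end Canonical

/-! ### The trivialization and the connection form given by a section of `H → H/N` -/

section Group

variable {EH EN EK : Type*} [NormedAddCommGroup EH] [NormedSpace ℝ EH] [FiniteDimensional ℝ EH]
  [NormedAddCommGroup EN] [NormedSpace ℝ EN]
  [NormedAddCommGroup EK] [NormedSpace ℝ EK]
  {H : Type*} [TopologicalSpace H] [ChartedSpace EH H] [Group H]
  {N : Subgroup H} [N.Normal] [ChartedSpace EN N]

/-- The trivialization `Σ : K × N → H`, `Σ(k, u) = σ(k) ι(u)`, where `K = H/N`. -/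
def trivialization (σ : H ⧸ N → H) (p : (H ⧸ N) × N) : H := σ p.1 * (p.2 : H)

/-- The differential at `h` of `R_{ι(u)} ∘ σ ∘ μ : H → H`, where `μ : H → H/N` is the quotient map
and `ι(u) = σ(μ(h))⁻¹ h`. As this map fixes `h`, this is an endomorphism of `T_h H`. -/
def horizontalProj (σ : H ⧸ N → H) (h : H) :
    TangentSpace 𝓘(ℝ, EH) h →L[ℝ] TangentSpace 𝓘(ℝ, EH) h :=
  (mfderiv 𝓘(ℝ, EH) 𝓘(ℝ, EH) (fun x : H => σ (x : H ⧸ N) * ((σ (h : H ⧸ N))⁻¹ * h)) h :)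

/-- The differential `TL_{h⁻¹}(h) : T_h H → T_e H` of the left translation by `h⁻¹`. -/
def leftTrivialize (h : H) :
    TangentSpace 𝓘(ℝ, EH) h →L[ℝ] TangentSpace 𝓘(ℝ, EH) (1 : H) :=
  (mfderiv 𝓘(ℝ, EH) 𝓘(ℝ, EH) (fun x : H => h⁻¹ * x) h :)

variable (N) in
/-- The differential `Tι(e) : T_e N → T_e H` of the inclusion `ι : N → H`. -/
def inclusionDeriv : TangentSpace 𝓘(ℝ, EN) (1 : N) →L[ℝ] TangentSpace 𝓘(ℝ, EH) (1 : H) :=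
  (mfderiv 𝓘(ℝ, EN) 𝓘(ℝ, EH) (Subtype.val : N → H) (1 : N) :)

variable (N) in
/-- `T(ι⁻¹)(e)`, the inverse of the injective map `Tι(e) : T_e N → T_e H`. It matters only
on the range of `Tι(e)`, and is extended to `T_e H` as a left inverse of `Tι(e)`. -/
def inclusionDerivInv : TangentSpace 𝓘(ℝ, EH) (1 : H) →L[ℝ] TangentSpace 𝓘(ℝ, EN) (1 : N) :=
  letI f : EN →ₗ[ℝ] EH := (inclusionDeriv (EH := EH) (EN := EN) N).toLinearMap
  letI g : EH →L[ℝ] EN := LinearMap.toContinuousLinearMap f.leftInverse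
  g

/-- The connection form determined by the section `σ`, a one-form on `H` with values in `T_e N`:
`α(v_h) = T(ι⁻¹ ∘ L_{h⁻¹})(h) (id - T(R_{ι(u)} ∘ σ ∘ μ)(h)) v_h`, where `ι(u) = σ(μ(h))⁻¹ h`. -/
def connectionForm (σ : H ⧸ N → H) :
    OneForm 𝓘(ℝ, EH) H (TangentSpace 𝓘(ℝ, EN) (1 : N)) :=
  fun h => (inclusionDerivInv N).comp ((leftTrivialize h).comp
    (ContinuousLinearMap.id ℝ (TangentSpace 𝓘(ℝ, EH) h) - horizontalProj σ h))

/-- The differential `TL_u(e) : T_e N → T_u N` of the left translation of `N` by `u`. -/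
def leftTranslationDeriv (u : N) :
    TangentSpace 𝓘(ℝ, EN) (1 : N) →L[ℝ] TangentSpace 𝓘(ℝ, EN) u :=
  (mfderiv 𝓘(ℝ, EN) 𝓘(ℝ, EN) (fun x : N => u * x) (1 : N) :)

end Group

end Magnetic

end

noncomputable section

namespace Magnetic

/-! ### Smoothness of maps into a cotangent bundle. -/

section Cotangent

variable {E F G : Type*} [NormedAddCommGroup E] [NormedSpace ℝ E]
  [NormedAddCommGroup F] [NormedSpace ℝ F] [NormedAddCommGroup G] [NormedSpace ℝ G]
  {M : Type*} [TopologicalSpace M] [ChartedSpace E M] [IsManifold 𝓘(ℝ, E) ∞ M]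
  {Q : Type*} [TopologicalSpace Q] [ChartedSpace F Q] [IsManifold 𝓘(ℝ, F) ∞ Q]
  {A : Type*} [TopologicalSpace A] {I : ModelWithCorners ℝ G A}
  {P : Type*} [TopologicalSpace P] [ChartedSpace A P]

/-! The map `Σ` is a diffeomorphism: its inverse is `h ↦ (μ(h), ν(h))` with `ν(h) = σ(μ(h))⁻¹ h`
(`fiberCoord`), and `ν` is smooth into `N` because `N` is embedded. Hence `(TΣ)⁻¹ = (Tμ, Tν)` and
`T*Σ(θ, χ) = θ ∘ Tμ + χ ∘ Tν`, which is smooth with no inverse of operators to differentiate.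

For `h = Σ(k, u)`, the map `R_{ι(u)} ∘ σ ∘ μ ∘ Σ` is `Σ(·, u)`, so `id - T(R_{ι(u)} ∘ σ ∘ μ)` leaves
of `TΣ(ξ, ν)` only the derivative along `N`. Since `Σ(k, u)⁻¹ Σ(k, u') = u⁻¹ u'`, this gives
`α(TΣ(ξ, ν)) = TL_{u⁻¹} ν` (`connectionForm_mfderiv_trivialization`), and `TL_u` restores `ν`.

Finally `T*Σ` covers `Σ`, so the pullback of `γ_H` is `θ` on the `K`-component of the projected
vector plus `χ` on its `N`-component (`covector_cotangentMap_mfderiv`), and these are the two terms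
of the formula. -/

theorem contMDiff_cotangentProj :
    ContMDiff (cotangentModel E) 𝓘(ℝ, E) ∞ (cotangentProj (M := M) (E := E)) :=
  Bundle.contMDiff_proj (fun x : M => TangentSpace 𝓘(ℝ, E) x →L[ℝ] Bundle.Trivial M ℝ x)

/-- The sum of two smooth families of covectors over the same family of base points is smooth. -/
theorem contMDiff_mkCovector_add {b : P → M}
    {φ ψ : ∀ p, TangentSpace 𝓘(ℝ, E) (b p) →L[ℝ] ℝ}
    (hφ : ContMDiff I (cotangentModel E) ∞ (fun p => mkCovector (b p) (φ p)))
    (hψ : ContMDiff I (cotangentModel E) ∞ (fun p => mkCovector (b p) (ψ p))) :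
    ContMDiff I (cotangentModel E) ∞ (fun p => mkCovector (b p) (φ p + ψ p)) := by
  intro p
  have h1 := (contMDiffAt_hom_bundle _).1 (hφ p)
  have h2 := (contMDiffAt_hom_bundle _).1 (hψ p)
  refine (contMDiffAt_hom_bundle _).2 ⟨h1.1, ?_⟩
  refine (h1.2.add h2.2).congr_of_eventuallyEq (Filter.Eventually.of_forall fun q => ?_)
  simp only [ContinuousLinearMap.inCoordinates, mkCovector, Pi.add_apply]
  erw [ContinuousLinearMap.add_comp, ContinuousLinearMap.comp_add]

/-- Composing a smooth family of covectors with the differential of a smooth map gives a smooth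
family of covectors. -/
theorem contMDiff_mkCovector_comp_mfderiv {g : Q → M} (hg : ContMDiff 𝓘(ℝ, F) 𝓘(ℝ, E) ∞ g)
    {b : P → Q} (hb : ContMDiff I 𝓘(ℝ, F) ∞ b)
    {φ : ∀ p, TangentSpace 𝓘(ℝ, E) (g (b p)) →L[ℝ] ℝ}
    (hφ : ContMDiff I (cotangentModel E) ∞ (fun p => mkCovector (g (b p)) (φ p))) :
    ContMDiff I (cotangentModel F) ∞
      (fun p => mkCovector (b p) ((φ p).comp (mfderiv 𝓘(ℝ, F) 𝓘(ℝ, E) g (b p)))) := by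
  intro p
  have h1 := (contMDiffAt_hom_bundle _).1 (hφ p)
  refine (contMDiffAt_hom_bundle _).2 ⟨hb p, ?_⟩
  have h2 : ContMDiffAt I 𝓘(ℝ, F →L[ℝ] E) ∞
      (inTangentCoordinates 𝓘(ℝ, F) 𝓘(ℝ, E) b (fun q => g (b q))
        (fun q => mfderiv 𝓘(ℝ, F) 𝓘(ℝ, E) g (b q)) p) p :=
    ((hg (b p)).mfderiv_const (m := ∞) le_rfl).comp p (hb p)
  refine (h1.2.clm_comp h2).congr_of_eventuallyEq ?_
  -- Near `p` the chart at `g (b p)` still covers `g (b q)`, so the coordinate change inserted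
  -- between `φ q` and `Tg` cancels with its inverse.
  have hU : ∀ᶠ q in nhds p, g (b q) ∈
      (trivializationAt E (TangentSpace 𝓘(ℝ, E) : M → Type _) (g (b p))).baseSet :=
    (hg.continuous.comp hb.continuous).continuousAt.eventually_mem
      ((trivializationAt E (TangentSpace 𝓘(ℝ, E) : M → Type _) (g (b p))).open_baseSet.mem_nhds
        (FiberBundle.mem_baseSet_trivializationAt' _))
  filter_upwards [hU] with q hq
  ext v
  simp only [ContinuousLinearMap.inCoordinates, inTangentCoordinates, mkCovector,
    ContinuousLinearMap.comp_apply]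
  exact congrArg _ (congrArg (φ q) (Bundle.Trivialization.symmL_continuousLinearMapAt (R := ℝ)
    (trivializationAt E (TangentSpace 𝓘(ℝ, E) : M → Type _) (g (b p))) hq _).symm)

end Cotangent

/-! ### The diffeomorphism `K × N ≃ H` defined by the section. -/

section Group

variable {EH EN EK : Type*} [NormedAddCommGroup EH] [NormedSpace ℝ EH]
  [NormedAddCommGroup EN] [NormedSpace ℝ EN]
  [NormedAddCommGroup EK] [NormedSpace ℝ EK]
  {H : Type*} [TopologicalSpace H] [ChartedSpace EH H] [Group H]
  {N : Subgroup H} [N.Normal] [ChartedSpace EN N] [ChartedSpace EK (H ⧸ N)]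

/-- The `N`-component `σ(μ(h))⁻¹ h` of `h` in the trivialization given by the section `σ`. -/
def fiberCoord (σ : H ⧸ N → H) (hsec : ∀ k : H ⧸ N, (σ k : H ⧸ N) = k) (h : H) : N :=
  ⟨(σ h)⁻¹ * h, QuotientGroup.eq.1 (hsec h)⟩

omit [TopologicalSpace H] [N.Normal] in
theorem mk_trivialization {σ : H ⧸ N → H} (hsec : ∀ k : H ⧸ N, (σ k : H ⧸ N) = k)
    (p : (H ⧸ N) × N) : ((trivialization σ p : H) : H ⧸ N) = p.1 := by
  rw [trivialization, QuotientGroup.mk_mul_of_mem _ p.2.2, hsec]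

variable [LieGroup 𝓘(ℝ, EH) ∞ H]

omit [N.Normal] in
theorem contMDiff_trivialization
    (hι : ContMDiff 𝓘(ℝ, EN) 𝓘(ℝ, EH) ∞ (Subtype.val : N → H))
    {σ : H ⧸ N → H} (hσ : ContMDiff 𝓘(ℝ, EK) 𝓘(ℝ, EH) ∞ σ) :
    ContMDiff (𝓘(ℝ, EK).prod 𝓘(ℝ, EN)) 𝓘(ℝ, EH) ∞ (trivialization σ) :=
  (hσ.comp contMDiff_fst).mul (hι.comp contMDiff_snd)

-- A map into an embedded submanifold is smooth once it is smooth into the ambient manifold;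
-- continuity into `N` comes from the subspace topology.
omit [N.Normal] in
theorem contMDiff_fiberCoord
    (hι : Manifold.IsSmoothEmbedding 𝓘(ℝ, EN) 𝓘(ℝ, EH) ∞ (Subtype.val : N → H))
    (hμ : ContMDiff 𝓘(ℝ, EH) 𝓘(ℝ, EK) ∞ (fun h : H => (h : H ⧸ N)))
    {σ : H ⧸ N → H} (hσ : ContMDiff 𝓘(ℝ, EK) 𝓘(ℝ, EH) ∞ σ)
    (hsec : ∀ k : H ⧸ N, (σ k : H ⧸ N) = k) :
    ContMDiff 𝓘(ℝ, EH) 𝓘(ℝ, EN) ∞ (fiberCoord σ hsec) := by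
  have h : ContMDiff 𝓘(ℝ, EH) 𝓘(ℝ, EH) ∞ (Subtype.val ∘ fiberCoord σ hsec) :=
    (hσ.comp hμ).inv.mul contMDiff_id
  exact (ContMDiff.iff_comp_isImmersion hι.isImmersion).2
    ⟨hι.isEmbedding.continuous_iff.2 h.continuous, h⟩

/-- The diffeomorphism `K × N ≃ H` given by a smooth section of the quotient map `H → K = H/N`. -/
def trivializationDiffeomorph
    (hι : Manifold.IsSmoothEmbedding 𝓘(ℝ, EN) 𝓘(ℝ, EH) ∞ (Subtype.val : N → H))
    (hμ : ContMDiff 𝓘(ℝ, EH) 𝓘(ℝ, EK) ∞ (fun h : H => (h : H ⧸ N)))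
    (σ : H ⧸ N → H) (hσ : ContMDiff 𝓘(ℝ, EK) 𝓘(ℝ, EH) ∞ σ)
    (hsec : ∀ k : H ⧸ N, (σ k : H ⧸ N) = k) :
    Diffeomorph (𝓘(ℝ, EK).prod 𝓘(ℝ, EN)) 𝓘(ℝ, EH) ((H ⧸ N) × N) H ∞ where
  toFun := trivialization σ
  invFun h := (h, fiberCoord σ hsec h)
  left_inv p := by
    refine Prod.ext (mk_trivialization hsec p) (Subtype.ext ?_)
    change (σ (trivialization σ p : H))⁻¹ * trivialization σ p = p.2
    rw [mk_trivialization hsec]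
    exact inv_mul_cancel_left _ _
  right_inv h := mul_inv_cancel_left _ _
  contMDiff_toFun := contMDiff_trivialization hι.contMDiff hσ
  contMDiff_invFun := hμ.prodMk (contMDiff_fiberCoord hι hμ hσ hsec)

end Group

/-! ### Vertical vectors and their translates to the neutral element. -/

section Connection

variable {EH EN EK : Type*}
  [NormedAddCommGroup EH] [NormedSpace ℝ EH] [FiniteDimensional ℝ EH]
  [NormedAddCommGroup EN] [NormedSpace ℝ EN] [FiniteDimensional ℝ EN]
  [NormedAddCommGroup EK] [NormedSpace ℝ EK]
  {H : Type*} [TopologicalSpace H] [ChartedSpace EH H] [Group H] [LieGroup 𝓘(ℝ, EH) ∞ H]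
  {N : Subgroup H} [N.Normal] [ChartedSpace EN N] [LieGroup 𝓘(ℝ, EN) ∞ N]
  [ChartedSpace EK (H ⧸ N)]

omit [FiniteDimensional ℝ EH] [FiniteDimensional ℝ EN] [LieGroup 𝓘(ℝ, EN) ∞ N] in
theorem inclusionDeriv_injective
    (hι : Manifold.IsSmoothEmbedding 𝓘(ℝ, EN) 𝓘(ℝ, EH) ∞ (Subtype.val : N → H))
    (hμ : ContMDiff 𝓘(ℝ, EH) 𝓘(ℝ, EK) ∞ (fun h : H => (h : H ⧸ N)))
    {σ : H ⧸ N → H} (hσ : ContMDiff 𝓘(ℝ, EK) 𝓘(ℝ, EH) ∞ σ)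
    (hsec : ∀ k : H ⧸ N, (σ k : H ⧸ N) = k) :
    Function.Injective (inclusionDeriv (EH := EH) (EN := EN) N) := by
  -- A smooth left inverse of the inclusion. As `σ 1` need not be neutral, `u` is first moved to `σ
  -- 1 * u = Σ(1, u)`.
  have hg : ContMDiff 𝓘(ℝ, EH) 𝓘(ℝ, EN) ∞ (fun x : H => fiberCoord σ hsec (σ 1 * x)) :=
    (contMDiff_fiberCoord hι hμ hσ hsec).comp (contMDiff_const.mul contMDiff_id)
  have hgf : (fun x : H => fiberCoord σ hsec (σ 1 * x)) ∘ (Subtype.val : N → H) = id :=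
    funext fun u => congrArg Prod.snd
      ((trivializationDiffeomorph hι hμ σ hσ hsec).left_inv (1, u))
  have h1 := ((hg.mdifferentiable (by simp) ((1 : N) : H)).hasMFDerivAt).comp (1 : N)
    (hι.contMDiff.mdifferentiable (by simp) (1 : N)).hasMFDerivAt
  rw [hgf] at h1
  have h2 := hasMFDerivAt_unique h1 (hasMFDerivAt_id (1 : N))
  exact Function.LeftInverse.injective (g := mfderiv 𝓘(ℝ, EH) 𝓘(ℝ, EN)
    (fun x : H => fiberCoord σ hsec (σ 1 * x)) ((1 : N) : H)) fun v => DFunLike.congr_fun h2 v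

omit [FiniteDimensional ℝ EN] [LieGroup 𝓘(ℝ, EH) ∞ H] [N.Normal] [LieGroup 𝓘(ℝ, EN) ∞ N] in
theorem inclusionDerivInv_inclusionDeriv
    (h : Function.Injective (inclusionDeriv (EH := EH) (EN := EN) N))
    (v : TangentSpace 𝓘(ℝ, EN) (1 : N)) :
    inclusionDerivInv (EH := EH) N (inclusionDeriv N v) = v :=
  LinearMap.leftInverse_apply_of_inj (LinearMap.ker_eq_bot.2 h) v

omit [FiniteDimensional ℝ EH] [FiniteDimensional ℝ EN] [N.Normal] in
/-- The vertical part of the vector `TΣ(k, u)(ξ, ν)`, translated to the neutral element, is the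
image under `Tι(e)` of the translate of `ν`. -/
theorem leftTrivialize_sub_horizontalProj
    (hι : ContMDiff 𝓘(ℝ, EN) 𝓘(ℝ, EH) ∞ (Subtype.val : N → H))
    (hμ : ContMDiff 𝓘(ℝ, EH) 𝓘(ℝ, EK) ∞ (fun h : H => (h : H ⧸ N)))
    {σ : H ⧸ N → H} (hσ : ContMDiff 𝓘(ℝ, EK) 𝓘(ℝ, EH) ∞ σ)
    (hsec : ∀ k : H ⧸ N, (σ k : H ⧸ N) = k) (p : (H ⧸ N) × N)
    (w : TangentSpace (𝓘(ℝ, EK).prod 𝓘(ℝ, EN)) p) :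
    leftTrivialize (trivialization σ p)
        (mfderiv (𝓘(ℝ, EK).prod 𝓘(ℝ, EN)) 𝓘(ℝ, EH) (trivialization σ) p w -
          horizontalProj σ (trivialization σ p)
            (mfderiv (𝓘(ℝ, EK).prod 𝓘(ℝ, EN)) 𝓘(ℝ, EH) (trivialization σ) p w)) =
      inclusionDeriv (EH := EH) (EN := EN) N (leftTrivialize p.2 w.2) := by
  have hS : MDifferentiableAt (𝓘(ℝ, EK).prod 𝓘(ℝ, EN)) 𝓘(ℝ, EH) (trivialization σ) p :=
    (contMDiff_trivialization hι hσ).mdifferentiable (by simp) p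
  have hS' := hS.hasMFDerivAt
  have hfix : (σ (trivialization σ p : H))⁻¹ * trivialization σ p = p.2 := by
    rw [mk_trivialization hsec, trivialization, inv_mul_cancel_left]
  have hΦ : ContMDiff 𝓘(ℝ, EH) 𝓘(ℝ, EH) ∞ (fun x : H =>
      σ (x : H ⧸ N) * ((σ (trivialization σ p : H))⁻¹ * trivialization σ p)) :=
    (hσ.comp hμ).mul contMDiff_const
  have hhor := ((hΦ.mdifferentiable (by simp) (trivialization σ p)).hasMFDerivAt).comp p hS'
  -- The right factor is frozen at `p.2`, so composing with `Σ` varies only the `K`-coordinate.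
  have hcomp : (fun x : H =>
      σ (x : H ⧸ N) * ((σ (trivialization σ p : H))⁻¹ * trivialization σ p)) ∘ trivialization σ =
      fun z => trivialization σ (z.1, p.2) := by
    funext z
    simp only [Function.comp_apply, hfix, mk_trivialization hsec z]
    rfl
  rw [hcomp] at hhor
  have hadd := mfderiv_prod_eq_add hS
  have hV : ContMDiff (𝓘(ℝ, EK).prod 𝓘(ℝ, EN)) 𝓘(ℝ, EH) ∞
      (fun z : (H ⧸ N) × N => trivialization σ (p.1, z.2)) :=
    (contMDiff_trivialization hι hσ).comp (contMDiff_const.prodMk contMDiff_snd)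
  have hver := (hV.mdifferentiable (by simp) p).hasMFDerivAt
  have hL : ContMDiff 𝓘(ℝ, EH) 𝓘(ℝ, EH) ∞ (fun x : H => (trivialization σ p)⁻¹ * x) :=
    contMDiff_const.mul contMDiff_id
  have hl := ((hL.mdifferentiable (by simp) (trivialization σ p)).hasMFDerivAt).comp
    (f := fun z : (H ⧸ N) × N => trivialization σ (p.1, z.2)) p hver
  have hLN : ContMDiff 𝓘(ℝ, EN) 𝓘(ℝ, EN) ∞ (fun x : N => p.2⁻¹ * x) :=
    contMDiff_const.mul contMDiff_id
  have hr1 := ((hLN.mdifferentiable (by simp) p.2).hasMFDerivAt).comp p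
    (hasMFDerivAt_snd (I := 𝓘(ℝ, EK)) (I' := 𝓘(ℝ, EN)) p)
  -- The chain rule needs the derivative at `p.2⁻¹ * p.2`, which equals `1` only propositionally.
  have hι1 (u : N) (hu : u = 1) : HasMFDerivAt 𝓘(ℝ, EN) 𝓘(ℝ, EH) (Subtype.val : N → H) u
      (inclusionDeriv (EH := EH) (EN := EN) N : EN →L[ℝ] EH) := by
    subst hu
    exact (hι.mdifferentiable (by simp) (1 : N)).hasMFDerivAt
  have hr := (hι1 _ (inv_mul_cancel p.2)).comp p hr1
  have heq : (fun x : H => (trivialization σ p)⁻¹ * x) ∘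
      (fun z : (H ⧸ N) × N => trivialization σ (p.1, z.2)) =
      Subtype.val ∘ (fun x : N => p.2⁻¹ * x) ∘ Prod.snd := by
    funext z
    simp [trivialization, mul_assoc]
  rw [heq] at hl
  have hlr := DFunLike.congr_fun (hasMFDerivAt_unique hl hr) w
  -- `TΣ` is the sum of its two partial derivatives, and the horizontal part is exactly the one
  -- along `K`.
  have hdiff : (mfderiv (𝓘(ℝ, EK).prod 𝓘(ℝ, EN)) 𝓘(ℝ, EH) (trivialization σ) p w -
          horizontalProj σ (trivialization σ p)
            (mfderiv (𝓘(ℝ, EK).prod 𝓘(ℝ, EN)) 𝓘(ℝ, EH) (trivialization σ) p w) : EH) =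
      mfderiv (𝓘(ℝ, EK).prod 𝓘(ℝ, EN)) 𝓘(ℝ, EH)
        (fun z : (H ⧸ N) × N => trivialization σ (p.1, z.2)) p w := by
    have h1 := DFunLike.congr_fun hhor.mfderiv w
    have h2 := DFunLike.congr_fun hadd w
    rw [sub_eq_iff_eq_add']
    refine h2.trans ?_
    exact congrArg (· + (_ : EH)) h1
  exact (congrArg (leftTrivialize (trivialization σ p)) hdiff).trans hlr

end Connection
-- Cancellation of left translations.
section Translation

variable {E : Type*} [NormedAddCommGroup E] [NormedSpace ℝ E]
  {G : Type*} [TopologicalSpace G] [Group G]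

/-- `TL_u(e) ∘ TL_{u⁻¹}(u)` is the identity of `T_u N`. -/
theorem leftTranslationDeriv_leftTrivialize {N : Subgroup G} [ChartedSpace E N]
    [LieGroup 𝓘(ℝ, E) ∞ N] (u : N) (v : TangentSpace 𝓘(ℝ, E) u) :
    leftTranslationDeriv u (leftTrivialize u v) = v := by
  have h (a : N) : MDifferentiable 𝓘(ℝ, E) 𝓘(ℝ, E) (fun x : N => a * x) :=
    ((contMDiff_const (n := ∞)).mul contMDiff_id).mdifferentiable (by simp)
  have h1 (a : N) (ha : a = 1) : HasMFDerivAt 𝓘(ℝ, E) 𝓘(ℝ, E) (fun x : N => u * x) a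
      (leftTranslationDeriv u : E →L[ℝ] E) := by
    subst ha
    exact (h u 1).hasMFDerivAt
  have h2 := (h1 _ (inv_mul_cancel u)).comp u (h u⁻¹ u).hasMFDerivAt
  have h3 : (fun x : N => u * x) ∘ (fun x : N => u⁻¹ * x) = id :=
    funext fun x => mul_inv_cancel_left u x
  rw [h3] at h2
  exact DFunLike.congr_fun (hasMFDerivAt_unique h2 (hasMFDerivAt_id u)) v

end Translation

/-- Needed because the base points of `θ` and `χ` agree with `μ(Σ(k, u))` and `ν(Σ(k, u))` only
propositionally. -/
theorem mkCovector_eq {E : Type*} [NormedAddCommGroup E] [NormedSpace ℝ E]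
    {M : Type*} [TopologicalSpace M] [ChartedSpace E M] [IsManifold 𝓘(ℝ, E) ∞ M]
    (c : CotangentBundle (E := E) M) {x : M} (hx : x = c.proj) :
    mkCovector x (c.snd : E →L[ℝ] ℝ) = c := by
  subst hx
  rfl

/-! ### Smoothness of `T*Σ`, and the formula for the pulled back canonical form. -/

section Main

variable {EH EN EK : Type*}
  [NormedAddCommGroup EH] [NormedSpace ℝ EH] [FiniteDimensional ℝ EH]
  [NormedAddCommGroup EN] [NormedSpace ℝ EN]
  [NormedAddCommGroup EK] [NormedSpace ℝ EK]
  {H : Type*} [TopologicalSpace H] [ChartedSpace EH H] [Group H] [LieGroup 𝓘(ℝ, EH) ∞ H]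
  {N : Subgroup H} [N.Normal] [ChartedSpace EN N] [LieGroup 𝓘(ℝ, EN) ∞ N]
  [ChartedSpace EK (H ⧸ N)] [LieGroup 𝓘(ℝ, EK) ∞ (H ⧸ N)]
  (hι : Manifold.IsSmoothEmbedding 𝓘(ℝ, EN) 𝓘(ℝ, EH) ∞ (Subtype.val : N → H))
  (hμ : ContMDiff 𝓘(ℝ, EH) 𝓘(ℝ, EK) ∞ (fun h : H => (h : H ⧸ N)))
  {σ : H ⧸ N → H} (hσ : ContMDiff 𝓘(ℝ, EK) 𝓘(ℝ, EH) ∞ σ)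
  (hsec : ∀ k : H ⧸ N, (σ k : H ⧸ N) = k)

include hι hμ hσ hsec

omit [FiniteDimensional ℝ EH] [N.Normal] [LieGroup 𝓘(ℝ, EN) ∞ N]
  [LieGroup 𝓘(ℝ, EK) ∞ (H ⧸ N)] in
theorem isInvertible_mfderiv_trivialization (p : (H ⧸ N) × N) :
    (mfderiv (𝓘(ℝ, EK).prod 𝓘(ℝ, EN)) 𝓘(ℝ, EH) (trivialization σ) p).IsInvertible :=
  ⟨(trivializationDiffeomorph hι hμ σ hσ hsec).mfderivToContinuousLinearEquiv (x := p) (by simp),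
    rfl⟩

omit [FiniteDimensional ℝ EH] [N.Normal] [LieGroup 𝓘(ℝ, EN) ∞ N]
  [LieGroup 𝓘(ℝ, EK) ∞ (H ⧸ N)] in
theorem mfderiv_mk_trivialization (p : (H ⧸ N) × N)
    (w : TangentSpace (𝓘(ℝ, EK).prod 𝓘(ℝ, EN)) p) :
    (mfderiv 𝓘(ℝ, EH) 𝓘(ℝ, EK) (fun h : H => (h : H ⧸ N)) (trivialization σ p)
      (mfderiv (𝓘(ℝ, EK).prod 𝓘(ℝ, EN)) 𝓘(ℝ, EH) (trivialization σ) p w) : EK) = w.1 := by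
  have h := ((hμ.mdifferentiable (by simp) (trivialization σ p)).hasMFDerivAt).comp p
    ((contMDiff_trivialization hι.contMDiff hσ).mdifferentiable (by simp) p).hasMFDerivAt
  have heq : (fun h : H => (h : H ⧸ N)) ∘ trivialization σ = Prod.fst :=
    funext (mk_trivialization hsec)
  rw [heq] at h
  exact DFunLike.congr_fun (hasMFDerivAt_unique h (hasMFDerivAt_fst p)) w

omit [FiniteDimensional ℝ EH] [N.Normal] [LieGroup 𝓘(ℝ, EN) ∞ N]
  [LieGroup 𝓘(ℝ, EK) ∞ (H ⧸ N)] in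
theorem mfderiv_fiberCoord_trivialization (p : (H ⧸ N) × N)
    (w : TangentSpace (𝓘(ℝ, EK).prod 𝓘(ℝ, EN)) p) :
    (mfderiv 𝓘(ℝ, EH) 𝓘(ℝ, EN) (fiberCoord σ hsec) (trivialization σ p)
      (mfderiv (𝓘(ℝ, EK).prod 𝓘(ℝ, EN)) 𝓘(ℝ, EH) (trivialization σ) p w) : EN) = w.2 := by
  have h := (((contMDiff_fiberCoord hι hμ hσ hsec).mdifferentiable (by simp)
    (trivialization σ p)).hasMFDerivAt).comp p
    ((contMDiff_trivialization hι.contMDiff hσ).mdifferentiable (by simp) p).hasMFDerivAt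
  have heq : fiberCoord σ hsec ∘ trivialization σ = Prod.snd :=
    funext fun q => congrArg Prod.snd ((trivializationDiffeomorph hι hμ σ hσ hsec).left_inv q)
  rw [heq] at h
  exact DFunLike.congr_fun (hasMFDerivAt_unique h (hasMFDerivAt_snd p)) w

omit [FiniteDimensional ℝ EH] [N.Normal] [LieGroup 𝓘(ℝ, EN) ∞ N]
  [LieGroup 𝓘(ℝ, EK) ∞ (H ⧸ N)] in
/-- `T*Σ(θ, χ)` evaluated on `TΣ(k, u)(ξ, ν)` is `θ ξ + χ ν`. -/
theorem covector_cotangentMap_mfderiv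
    (q : CotangentBundle (E := EK) (H ⧸ N) × CotangentBundle (E := EN) N)
    (w : TangentSpace (𝓘(ℝ, EK).prod 𝓘(ℝ, EN)) (cotangentProj q.1, cotangentProj q.2)) :
    covector (cotangentMap (E := EK) (E' := EN) (F := EH) (trivialization σ) q)
        (mfderiv (𝓘(ℝ, EK).prod 𝓘(ℝ, EN)) 𝓘(ℝ, EH) (trivialization σ)
          (cotangentProj q.1, cotangentProj q.2) w) =
      covector q.1 w.1 + covector q.2 w.2 := by
  have h : (mfderiv (𝓘(ℝ, EK).prod 𝓘(ℝ, EN)) 𝓘(ℝ, EH) (trivialization σ)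
      (cotangentProj q.1, cotangentProj q.2)).inverse
        (mfderiv (𝓘(ℝ, EK).prod 𝓘(ℝ, EN)) 𝓘(ℝ, EH) (trivialization σ)
          (cotangentProj q.1, cotangentProj q.2) w) = w := by
    obtain ⟨e, he⟩ := isInvertible_mfderiv_trivialization hι hμ hσ hsec
      (cotangentProj q.1, cotangentProj q.2)
    rw [← he, ContinuousLinearMap.inverse_equiv]
    exact e.symm_apply_apply w
  exact congrArg ((covector q.1).coprod (covector q.2)) h

omit [FiniteDimensional ℝ EH] in
theorem contMDiff_cotangentMap_trivialization :
    ContMDiff ((cotangentModel EK).prod (cotangentModel EN)) (cotangentModel EH) ∞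
      (cotangentMap (E := EK) (E' := EN) (F := EH) (trivialization σ)) := by
  let b : CotangentBundle (E := EK) (H ⧸ N) × CotangentBundle (E := EN) N → H :=
    fun q => trivialization σ (cotangentProj q.1, cotangentProj q.2)
  have hb : ContMDiff ((cotangentModel EK).prod (cotangentModel EN)) 𝓘(ℝ, EH) ∞ b :=
    (contMDiff_trivialization hι.contMDiff hσ).comp
      ((contMDiff_cotangentProj.comp contMDiff_fst).prodMk
        (contMDiff_cotangentProj.comp contMDiff_snd))
  -- `h1` and `h2` give the summands `θ ∘ Tμ` and `χ ∘ Tν`; their sum is compared with `T*Σ` on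
  -- vectors `TΣ w`, which exhaust the tangent space.
  have h1 := contMDiff_mkCovector_comp_mfderiv hμ hb (φ := fun q => q.1.snd)
    (contMDiff_fst.congr fun q => mkCovector_eq q.1 (mk_trivialization hsec _))
  have h2 := contMDiff_mkCovector_comp_mfderiv (contMDiff_fiberCoord hι hμ hσ hsec) hb
    (φ := fun q => q.2.snd)
    (contMDiff_snd.congr fun q => mkCovector_eq q.2 (congrArg Prod.snd
      ((trivializationDiffeomorph hι hμ σ hσ hsec).left_inv (q.1.proj, q.2.proj))))
  refine (contMDiff_mkCovector_add h1 h2).congr fun q => ?_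
  refine congrArg (mkCovector (b q)) (ContinuousLinearMap.ext fun v => ?_)
  obtain ⟨e, he⟩ := isInvertible_mfderiv_trivialization hι hμ hσ hsec
    (cotangentProj q.1, cotangentProj q.2)
  obtain ⟨w, rfl⟩ : ∃ w, mfderiv (𝓘(ℝ, EK).prod 𝓘(ℝ, EN)) 𝓘(ℝ, EH) (trivialization σ)
      (cotangentProj q.1, cotangentProj q.2) w = v :=
    ⟨e.symm v, by rw [← he]; exact e.apply_symm_apply v⟩
  refine (covector_cotangentMap_mfderiv hι hμ hσ hsec q w).trans ?_
  exact (congrArg₂ (· + ·)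
    (congrArg (covector q.1) (mfderiv_mk_trivialization hι hμ hσ hsec _ w))
    (congrArg (covector q.2) (mfderiv_fiberCoord_trivialization hι hμ hσ hsec _ w))).symm

omit [LieGroup 𝓘(ℝ, EK) ∞ (H ⧸ N)] in
/-- The connection form on the image of `TΣ`. -/
theorem connectionForm_mfderiv_trivialization (p : (H ⧸ N) × N)
    (w : TangentSpace (𝓘(ℝ, EK).prod 𝓘(ℝ, EN)) p) :
    connectionForm (EH := EH) (EN := EN) σ (trivialization σ p)
      (mfderiv (𝓘(ℝ, EK).prod 𝓘(ℝ, EN)) 𝓘(ℝ, EH) (trivialization σ) p w) =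
      leftTrivialize p.2 w.2 :=
  (congrArg (inclusionDerivInv N)
    (leftTrivialize_sub_horizontalProj hι.contMDiff hμ hσ hsec p w)).trans
    (inclusionDerivInv_inclusionDeriv (inclusionDeriv_injective hι hμ hσ hsec) _)

-- Every `v` has the form `TΣ w`, and there the right-hand side is already known to lie in the range
-- of `Tι(e)`.
omit [LieGroup 𝓘(ℝ, EK) ∞ (H ⧸ N)] in
theorem inclusionDeriv_connectionForm (h : H) (v : TangentSpace 𝓘(ℝ, EH) h) :
    inclusionDeriv (EH := EH) (EN := EN) N (connectionForm σ h v) =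
      leftTrivialize h (v - horizontalProj σ h v) := by
  obtain ⟨p, rfl⟩ : ∃ p, trivialization σ p = h :=
    (trivializationDiffeomorph hι hμ σ hσ hsec).surjective h
  obtain ⟨e, he⟩ := isInvertible_mfderiv_trivialization hι hμ hσ hsec p
  obtain ⟨w, rfl⟩ : ∃ w,
      mfderiv (𝓘(ℝ, EK).prod 𝓘(ℝ, EN)) 𝓘(ℝ, EH) (trivialization σ) p w = v :=
    ⟨e.symm v, by rw [← he]; exact e.apply_symm_apply v⟩
  rw [connectionForm_mfderiv_trivialization hι hμ hσ hsec]
  exact (leftTrivialize_sub_horizontalProj hι.contMDiff hμ hσ hsec p w).symm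

theorem pullback_cotangentMap_canonicalForm (θ : CotangentBundle (E := EK) (H ⧸ N))
    (χ : CotangentBundle (E := EN) N) :
    pullback ((cotangentModel EK).prod (cotangentModel EN)) (cotangentModel EH)
        (cotangentMap (E := EK) (E' := EN) (F := EH) (trivialization σ))
        (canonicalForm H) (θ, χ) =
      pullback ((cotangentModel EK).prod (cotangentModel EN)) (cotangentModel EK)
        Prod.fst (canonicalForm (H ⧸ N)) (θ, χ) +
      ((covector χ).comp (leftTranslationDeriv (cotangentProj χ))).comp
        (pullback ((cotangentModel EK).prod (cotangentModel EN)) 𝓘(ℝ, EH)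
          (fun p : CotangentBundle (E := EK) (H ⧸ N) × CotangentBundle (E := EN) N =>
            trivialization σ (cotangentProj p.1, cotangentProj p.2))
          (connectionForm σ) (θ, χ)) := by
  have hπK := ((contMDiff_cotangentProj (E := EK) (M := H ⧸ N)).mdifferentiable
    (by simp) θ).hasMFDerivAt
  have hπN := ((contMDiff_cotangentProj (E := EN) (M := N)).mdifferentiable
    (by simp) χ).hasMFDerivAt
  have hπ := (hπK.comp (θ, χ) (hasMFDerivAt_fst (I := cotangentModel EK)
    (I' := cotangentModel EN) (θ, χ))).prodMk
    (hπN.comp (θ, χ) (hasMFDerivAt_snd (I := cotangentModel EK)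
      (I' := cotangentModel EN) (θ, χ)))
  have hb := (((contMDiff_trivialization hι.contMDiff hσ).mdifferentiable (by simp)
    (cotangentProj θ, cotangentProj χ)).hasMFDerivAt).comp (θ, χ) hπ
  have hT := ((contMDiff_cotangentProj (E := EH) (M := H)).mdifferentiable (by simp)
    (cotangentMap (E := EK) (E' := EN) (F := EH) (trivialization σ) (θ, χ))).hasMFDerivAt.comp
    (θ, χ) ((contMDiff_cotangentMap_trivialization hι hμ hσ hsec).mdifferentiable (by simp)
      (θ, χ)).hasMFDerivAt
  -- `π*_H ∘ T*Σ` and `Σ ∘ (π*_K × π*_N)` are the same map by definition. The smoothness of `T*Σ`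
  -- enters through the chain rule in `hT`.
  have hTb := hasMFDerivAt_unique hT hb
  refine ContinuousLinearMap.ext fun X => ?_
  refine (congrArg (covector (cotangentMap (E := EK) (E' := EN) (F := EH) (trivialization σ)
    (θ, χ))) (DFunLike.congr_fun hTb X)).trans ?_
  refine (covector_cotangentMap_mfderiv hι hμ hσ hsec (θ, χ) _).trans ?_
  refine congrArg₂ (· + ·) ?_ ?_
  · exact congrArg (fun L => covector θ (mfderiv (cotangentModel EK) 𝓘(ℝ, EK) cotangentProj θ
      (L X))) (hasMFDerivAt_fst (I := cotangentModel EK)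
        (I' := cotangentModel EN) (θ, χ)).mfderiv.symm
  · refine congrArg (covector χ) ?_
    symm
    refine (congrArg (fun L => leftTranslationDeriv (EN := EN) (cotangentProj χ)
      (connectionForm (EH := EH) (EN := EN) σ (trivialization σ (cotangentProj θ, cotangentProj χ)) (L X)))
      hb.mfderiv).trans ?_
    refine (congrArg (leftTranslationDeriv (cotangentProj χ))
      (connectionForm_mfderiv_trivialization hι hμ hσ hsec _ _)).trans ?_
    exact leftTranslationDeriv_leftTrivialize _ _

end Main
end Magnetic

end

theorem proposition5p1
    {EH EN EK : Type*}
    [NormedAddCommGroup EH] [NormedSpace ℝ EH] [FiniteDimensional ℝ EH]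
    [NormedAddCommGroup EN] [NormedSpace ℝ EN] [FiniteDimensional ℝ EN]
    [NormedAddCommGroup EK] [NormedSpace ℝ EK] [FiniteDimensional ℝ EK]
    -- `H` is a Lie group, `N` a normal subgroup, `N` and `K = H/N` are Lie groups
    {H : Type*} [TopologicalSpace H] [ChartedSpace EH H] [Group H] [LieGroup 𝓘(ℝ, EH) ∞ H]
    (N : Subgroup H) [N.Normal]
    [ChartedSpace EN N] [LieGroup 𝓘(ℝ, EN) ∞ N]
    [ChartedSpace EK (H ⧸ N)] [LieGroup 𝓘(ℝ, EK) ∞ (H ⧸ N)]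
    -- `N → H → K` are homomorphisms of Lie groups, `N` being embedded
    (hι : Manifold.IsSmoothEmbedding 𝓘(ℝ, EN) 𝓘(ℝ, EH) ∞ (Subtype.val : N → H))
    (hμ : ContMDiff 𝓘(ℝ, EH) 𝓘(ℝ, EK) ∞ (fun h : H => (h : H ⧸ N)))
    -- `σ` is a smooth global section of `H → K`
    (σ : H ⧸ N → H) (hσ : ContMDiff 𝓘(ℝ, EK) 𝓘(ℝ, EH) ∞ σ)
    (hsec : ∀ k : H ⧸ N, (σ k : H ⧸ N) = k) :
    -- the tangent maps of `Σ` are invertible and `T*Σ` is smooth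
    (∀ p : (H ⧸ N) × N,
      (mfderiv (𝓘(ℝ, EK).prod 𝓘(ℝ, EN)) 𝓘(ℝ, EH)
        (Magnetic.trivialization σ) p).IsInvertible) ∧
    ContMDiff ((Magnetic.cotangentModel EK).prod (Magnetic.cotangentModel EN))
      (Magnetic.cotangentModel EH) ∞
      (Magnetic.cotangentMap (E := EK) (E' := EN) (F := EH) (Magnetic.trivialization σ)) ∧
    -- `TL_{h⁻¹}` maps vertical vectors into the range of the injective map `Tι(e)`,
    -- so that the defining formula of `α` makes sense
    Function.Injective (Magnetic.inclusionDeriv (EH := EH) (EN := EN) N) ∧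
    (∀ (h : H) (v : TangentSpace 𝓘(ℝ, EH) h),
      Magnetic.inclusionDeriv (EH := EH) (EN := EN) N (Magnetic.connectionForm σ h v) =
        Magnetic.leftTrivialize h (v - Magnetic.horizontalProj σ h v)) ∧
    -- the formula for the pullback of the canonical one-form
    ∀ (θ : Magnetic.CotangentBundle (E := EK) (H ⧸ N)) (χ : Magnetic.CotangentBundle (E := EN) N),
      Magnetic.pullback
          ((Magnetic.cotangentModel EK).prod (Magnetic.cotangentModel EN))
          (Magnetic.cotangentModel EH)
          (Magnetic.cotangentMap (E := EK) (E' := EN) (F := EH) (Magnetic.trivialization σ))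
          (Magnetic.canonicalForm H) (θ, χ) =
        Magnetic.pullback
          ((Magnetic.cotangentModel EK).prod (Magnetic.cotangentModel EN))
          (Magnetic.cotangentModel EK)
          Prod.fst
          (Magnetic.canonicalForm (H ⧸ N)) (θ, χ) +
        ((Magnetic.covector χ).comp
            (Magnetic.leftTranslationDeriv (Magnetic.cotangentProj χ))).comp
          (Magnetic.pullback
            ((Magnetic.cotangentModel EK).prod (Magnetic.cotangentModel EN))
            𝓘(ℝ, EH)
            (fun p : Magnetic.CotangentBundle (E := EK) (H ⧸ N) ×
                Magnetic.CotangentBundle (E := EN) N =>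
              Magnetic.trivialization σ
                (Magnetic.cotangentProj p.1, Magnetic.cotangentProj p.2))
            (Magnetic.connectionForm σ) (θ, χ)) := by
  exact ⟨Magnetic.isInvertible_mfderiv_trivialization hι hμ hσ hsec,
    Magnetic.contMDiff_cotangentMap_trivialization hι hμ hσ hsec,
    Magnetic.inclusionDeriv_injective hι hμ hσ hsec,
    Magnetic.inclusionDeriv_connectionForm hι hμ hσ hsec,
    Magnetic.pullback_cotangentMap_canonicalForm hι hμ hσ hsec⟩
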